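/- Let $N\ge 2$, let $X$ be a metrizable space and let $(\Phi(t))_{t\ge 0}$ be a continuous semiflow on $X$. Suppose that $\Phi$ is an extended dissipative system on $\mathbb{R}^N$: to each $u\in X$ are associated an energy density $e\in C^0(\mathbb{R}^N,\mathbb{R}_+)$, an energy flux $f\in C^0(\mathbb{R}^N,\mathbb{R}^N)$ and an energy dissipation rate $d\in C^0(\mathbb{R}^N,\mathbb{R}_+)$ such that (A1) $e,f,d$ depend continuously on $u$, uniformly on compact subsets of $\mathbb{R}^N$; (A2) $|f|^2\le b(e)\,d$ for some nondecreasing $b:\mathbb{R}_+\to\mathbb{R}_+$ independent of $u$; (A3) $d\equiv 0$ only if $\Phi(t)u=u$ for all $t\ge 0$; (A4) along every trajectory, $\partial_t e=\operatorname{div} f-d$ in the sense of distributions on $\mathbb{R}^N\times(0,\infty)$. Let $u(t)=\Phi(t)u_0$ be a trajectory, with associated quantities $e(x,t),f(x,t),d(x,t)$, and let $e_0>0$, $\beta>0$ be such that $e(x,0)\le e_0$ for all $x\in\mathbb{R}^N$ and $|f(x,t)|^2\le\beta\,d(x,t)$ for all $x\in\mathbb{R}^N$, $t\ge 0$. For $R,T>0$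 define the integrated energy flux \[ F(R,T)=\int_0^T\!\!\int_{|x|=R} f(x,t)\cdot\frac{x}{|x|}\,d\sigma\,dt , \] where $\sigma$ is the Euclidean surface measure on the sphere $|x|=R$, and put $\omega_N=2\pi^{N/2}/\Gamma(N/2)$ and \[ h_N(r)=\frac{K_{N/2}(r)}{K_{N/2-1}(r)},\qquad r>0, \] where $K_\nu(r)=\int_0^\infty e^{-r\cosh s}\cosh(\nu s)\,ds$ is the modified Bessel function of the second kind. Then $h_N$ is the unique positive solution on $(0,\infty)$ of the differential equation \[ H'(r)+\frac{N-1}{r}H(r)=-1+H(r)^2 , \] and for all $R>0$ and $T>0$, \[ \frac{F(R,T)}{\omega_N R^{N-1}}\le\sqrt{\beta T e_0}\;h_N\!\Bigl(R\sqrt{\frac{e_0}{\beta T}}\Bigr). \] -/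

import Mathlib

open MeasureTheory Set

open scoped NNReal ContDiff

/-- Euclidean space `ℝ^N`. -/
abbrev RN (N : ℕ) : Type := EuclideanSpace ℝ (Fin N)

/-- Space-time test functions: smooth real functions on `ℝ^N × ℝ` whose support is a compact
subset of `ℝ^N × (0, ∞)`. -/
structure IsTestFunction {N : ℕ} (φ : RN N × ℝ → ℝ) : Prop where
  smooth : ContDiff ℝ ∞ φ
  compact_support : HasCompactSupport φ
  support_subset : tsupport φ ⊆ univ ×ˢ Ioi (0 : ℝ)

/-- `∂_t e = div f - d` in the sense of distributions on `ℝ^N × (0, ∞)`: for all test functions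
`φ`, `∫∫ (e ∂_t φ - f · ∇φ - d φ) dx dt = 0`. The arguments of `e`, `f`, `d` are time and space;
`fderiv ℝ φ p (0, 1)` is `∂_t φ` and `fderiv ℝ φ p (v, 0)` is `v · ∇φ`. -/
def EnergyBalance {N : ℕ} (e : ℝ → RN N → ℝ) (f : ℝ → RN N → RN N) (d : ℝ → RN N → ℝ) : Prop :=
  ∀ φ : RN N × ℝ → ℝ, IsTestFunction φ →
    ∫ p : RN N × ℝ, (e p.2 p.1 * fderiv ℝ φ p (0, 1) - fderiv ℝ φ p (f p.2 p.1, 0)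
      - d p.2 p.1 * φ p) = 0

/-- The structure of an extended dissipative system on `ℝ^N` for a continuous semiflow `Φ` on a
metrizable space `X`: energy density `e`, energy flux `f` and energy dissipation rate `d`.
The spaces `C(RN N, _)` carry the topology of uniform convergence on compact sets. -/
structure ExtendedDissipativeSystem (N : ℕ) (X : Type*) [TopologicalSpace X]
    [TopologicalSpace.MetrizableSpace X] (Φ : Flow ℝ≥0 X) where
  e : X → C(RN N, ℝ)
  f : X → C(RN N, RN N)
  d : X → C(RN N, ℝ)
  e_nonneg : ∀ u x, 0 ≤ e u x
  d_nonneg : ∀ u x, 0 ≤ d u x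
  continuous_e : Continuous e
  continuous_f : Continuous f
  continuous_d : Continuous d
  flux_bound : ∃ b : ℝ≥0 → ℝ≥0, Monotone b ∧
    ∀ u x, ‖f u x‖ ^ 2 ≤ (b (e u x).toNNReal : ℝ) * d u x
  equilibrium : ∀ u, (∀ x, d u x = 0) → ∀ t, Φ t u = u
  energy_balance : ∀ u₀ : X, EnergyBalance
    (fun t x => e (Φ t.toNNReal u₀) x)
    (fun t x => f (Φ t.toNNReal u₀) x)
    (fun t x => d (Φ t.toNNReal u₀) x)

noncomputable section

/-- The area `ω_N = 2 π^{N/2} / Γ(N/2)` of the unit sphere of `ℝ^N`. -/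
def omegaN (N : ℕ) : ℝ := 2 * Real.pi ^ ((N : ℝ) / 2) / Real.Gamma ((N : ℝ) / 2)

/-- The Euclidean surface measure `σ` of the sphere `|x| = R` (for `R > 0`), as a measure on
`ℝ^N`: the surface measure of the unit sphere, dilated by `R` and multiplied by `R^{N-1}`. -/
def sphereMeasure (N : ℕ) (R : ℝ) : Measure (RN N) :=
  ENNReal.ofReal (R ^ (N - 1)) •
    (volume : Measure (RN N)).toSphere.map
      (fun y : Metric.sphere (0 : RN N) 1 => R • (y : RN N))

/-- The integrated flux
`F(R,T) = ∫_0^T ∫_{|x|=R} f(x,t) · x/|x| dσ dt` along the trajectory of `u₀`. -/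
def ExtendedDissipativeSystem.integratedFlux {N : ℕ} {X : Type*} [TopologicalSpace X]
    [TopologicalSpace.MetrizableSpace X] {Φ : Flow ℝ≥0 X} (S : ExtendedDissipativeSystem N X Φ)
    (u₀ : X) (R T : ℝ) : ℝ :=
  ∫ t in (0 : ℝ)..T, ∫ x, inner ℝ (S.f (Φ t.toNNReal u₀) x) (‖x‖⁻¹ • x) ∂(sphereMeasure N R)

/-- The modified Bessel function of the second kind of real order `ν`, at `r > 0`:
`K_ν(r) = ∫_0^∞ exp(-r cosh s) cosh(ν s) ds`. -/
def besselK (ν r : ℝ) : ℝ :=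
  ∫ s in Ioi (0 : ℝ), Real.exp (-r * Real.cosh s) * Real.cosh (ν * s)

/-- `h_N(r) = K_{N/2}(r) / K_{N/2-1}(r)`. -/
def hN (N : ℕ) (r : ℝ) : ℝ := besselK ((N : ℝ) / 2) r / besselK ((N : ℝ) / 2 - 1) r

/-- `H` is positive on `(0, ∞)` and solves `H' + (N-1)/r H = -1 + H^2` there. -/
def IsPositiveRiccatiSolution (N : ℕ) (H : ℝ → ℝ) : Prop :=
  ∀ r : ℝ, 0 < r → 0 < H r ∧ DifferentiableAt ℝ H r ∧
    deriv H r + ((N : ℝ) - 1) / r * H r = -1 + H r ^ 2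

end

/-! Let `y(r)` be the flux `F(r,T)` divided by `ω_N r^{N-1}`. Energy balance over spheres says that
`y' + (N-1)/r · y` is the spherical mean of `e(T) - e(0) + ∫₀ᵀ d`. Here `e(T) ≥ 0`, `e(0) ≤ e₀`, and
Cauchy-Schwarz with `|f|² ≤ β d` gives mean dissipation at least `y²/(βT)`. Hence `y' + (N-1)/r · y
≥ -e₀ + y²/(βT)`, which after scaling is the Riccati inequality with constants `-1` and `1`
(`exists_hasDerivAt_flux`).

The bound comes from the fact that `y` is defined for all `r > 0`. If a supersolution exceeded `h_N`
at one point, the difference `D` would stay positive to the right and eventually satisfy `D' > D²`,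
so it would blow up at a finite radius (`riccati_supersolution_le`). Conversely, a positive solution
below `h_N` at one point would separate from it exponentially, although `h_N ≤ 2` far out; this
gives uniqueness. Both arguments use `h_N ≥ 1`, which holds because `K_ν` increases with `|ν|`; the
recurrences for `K_ν` show that `h_N` solves the equation.

The energy balance holds only in the sense of distributions. Testing it with `χ(|x|) ψ(t)` reduces
it to weak identities in `t` and in `r` between continuous functions, and a continuous weak
derivative is a classical one (`hasDerivAt_of_integral_mul_deriv_add_eq_zero`, used once in each
variable). -/

/-! ### The Riccati equation -/

/-- Exponential lower barrier for a function satisfying `D' > k D` wherever it is positive. -/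
theorem mul_exp_le_of_mul_lt_hasDerivAt {D D' : ℝ → ℝ} {a k : ℝ} (ha : 0 < D a)
    (hD : ∀ r, a ≤ r → HasDerivAt D (D' r) r)
    (hlt : ∀ r, a ≤ r → 0 < D r → k * D r < D' r) {r : ℝ} (hr : a ≤ r) :
    D a * Real.exp (k * (r - a)) ≤ D r := by
  -- Signs are reversed because the comparison principle gives upper bounds. The strict inequality
  -- is needed only where `D` meets the exponential, and there `D > 0`.
  have key := image_le_of_deriv_right_lt_deriv_boundary (f := fun x => -D x)
    (f' := fun x => -D' x) (a := a) (b := r)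
    (B := fun x => -(D a * Real.exp (k * (x - a))))
    (B' := fun x => -(D a * (Real.exp (k * (x - a)) * k)))
    (fun x hx => (hD x hx.1).neg.continuousAt.continuousWithinAt)
    (fun x hx => (hD x hx.1).neg.hasDerivWithinAt) (by simp)
    (fun x => by
      have h1 : HasDerivAt (fun x => k * (x - a)) k x := by
        simpa using ((hasDerivAt_id x).sub_const a).const_mul k
      exact (h1.exp.const_mul (D a)).neg)
    (fun x hx hxe => by
      have hxe' : D x = D a * Real.exp (k * (x - a)) := by linarith
      have hpos : 0 < D x := by rw [hxe']; positivity
      have := hlt x hx.1 hpos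
      rw [hxe'] at this
      linarith)
  have := key (right_mem_Icc.2 hr)
  linarith

/-- A supersolution of the Riccati equation `H' + (c/r) H = H² - 1` on `(0, ∞)` lies below any
solution that is bounded below by `1`. -/
theorem riccati_supersolution_le {c : ℝ} (hc : 0 ≤ c) {H H' h h' : ℝ → ℝ}
    (hH : ∀ r, 0 < r → HasDerivAt H (H' r) r)
    (hH' : ∀ r, 0 < r → -1 + H r ^ 2 ≤ H' r + c / r * H r)
    (hh : ∀ r, 0 < r → HasDerivAt h (h' r) r)
    (hh' : ∀ r, 0 < r → h' r + c / r * h r = -1 + h r ^ 2)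
    (hh1 : ∀ r, 0 < r → 1 ≤ h r) {r : ℝ} (hr : 0 < r) : H r ≤ h r := by
  by_contra! hlt
  have hD : ∀ x, 0 < x → HasDerivAt (fun x => H x - h x) (H' x - h' x) x :=
    fun x hx => (hH x hx).sub (hh x hx)
  have hge : ∀ x, 0 < x → (H x - h x) * (H x - h x + 2 * h x - c / x) ≤ H' x - h' x := by
    intro x hx
    have h1 := hH' x hx
    have h2 := hh' x hx
    linarith
  have hpos : ∀ x, r ≤ x → 0 < H x - h x := by
    intro x hx
    -- To the right of `r`, while `D > 0`, the factor `D + 2h - c/y` exceeds `-c/r`.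
    have := mul_exp_le_of_mul_lt_hasDerivAt (D := fun x => H x - h x) (k := -(c / r))
      (a := r) (by simpa using hlt) (fun y hy => hD y (hr.trans_le hy))
      (fun y hy hy0 => by
        have h0 : 0 < y := hr.trans_le hy
        refine lt_of_lt_of_le ?_ (hge y h0)
        have h1 : c / y ≤ c / r := by gcongr
        have h2 := hh1 y h0
        rw [mul_comm]
        exact mul_lt_mul_of_pos_left (by linarith) hy0) hx
    refine lt_of_lt_of_le ?_ this
    have : 0 < H r - h r := by linarith
    positivity
  -- Beyond `c`, `c/x ≤ 1 < 2h`, so `D' > D²` and `1/D` has slope below `-1`: it would reach zero no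
  -- later than `a + 1/D(a)`.
  set a := max r c with ha
  have ha0 : 0 < a := hr.trans_le (le_max_left _ _)
  have hra : r ≤ a := le_max_left _ _
  have hG0 : 0 < (H a - h a)⁻¹ := inv_pos.2 (hpos a hra)
  have key := image_le_of_deriv_right_lt_deriv_boundary (f := fun x => (H x - h x)⁻¹)
    (f' := fun x => -(H' x - h' x) / (H x - h x) ^ 2) (a := a) (b := a + (H a - h a)⁻¹)
    (B := fun x => (H a - h a)⁻¹ - (x - a)) (B' := fun _ => -1)
    (fun x hx => ((hD x (ha0.trans_le hx.1)).inv
      (hpos x (hra.trans hx.1)).ne').continuousAt.continuousWithinAt)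
    (fun x hx => ((hD x (ha0.trans_le hx.1)).inv
      (hpos x (hra.trans hx.1)).ne').hasDerivWithinAt) (by simp)
    (fun x => by simpa using ((hasDerivAt_id x).sub_const a).const_sub ((H a - h a)⁻¹))
    (fun x hx _ => by
      have hx0 : 0 < x := ha0.trans_le hx.1
      have hDx := hpos x (hra.trans hx.1)
      rw [div_lt_iff₀ (by positivity)]
      have h1 := hge x hx0
      have h2 := hh1 x hx0
      have h3 : c / x ≤ 1 := by
        rw [div_le_one hx0]
        exact (le_max_right _ _).trans hx.1
      have h4 : 0 < (H x - h x) * (2 * h x - c / x) := mul_pos hDx (by linarith)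
      nlinarith)
  have h1 := key (right_mem_Icc.2 (by linarith))
  have h2 : 0 < (H (a + (H a - h a)⁻¹) - h (a + (H a - h a)⁻¹))⁻¹ :=
    inv_pos.2 (hpos _ (by linarith))
  simp only [add_sub_cancel_left, sub_self] at h1
  linarith

/-- A positive global solution of the Riccati equation is at most `2` far from the origin. -/
theorem riccati_solution_le_two {c : ℝ} {H H' : ℝ → ℝ}
    (hpos : ∀ r, 0 < r → 0 < H r) (hH : ∀ r, 0 < r → HasDerivAt H (H' r) r)
    (hH' : ∀ r, 0 < r → H' r + c / r * H r = -1 + H r ^ 2) {a : ℝ} (ha : 0 < a)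
    (hac : 2 * c ≤ a) : H a ≤ 2 := by
  by_contra! hlt
  -- The barrier for `1/H` falls from `1/2` to `0` on `[a, a + 2]`. At a contact point `H ≥ 2` and
  -- `c/x ≤ 1/2`, so `H' ≥ H² - 1 - H/2 > H²/4`.
  have key := image_le_of_deriv_right_lt_deriv_boundary (f := fun x => (H x)⁻¹)
    (f' := fun x => -(H' x) / (H x) ^ 2) (a := a) (b := a + 2)
    (B := fun x => 1 / 2 - 1 / 4 * (x - a)) (B' := fun _ => -(1 / 4))
    (fun x hx => ((hH x (ha.trans_le hx.1)).inv
      (hpos x (ha.trans_le hx.1)).ne').continuousAt.continuousWithinAt)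
    (fun x hx => ((hH x (ha.trans_le hx.1)).inv
      (hpos x (ha.trans_le hx.1)).ne').hasDerivWithinAt)
    (by
      simp only [sub_self, mul_zero, sub_zero, one_div]
      exact inv_anti₀ two_pos hlt.le)
    (fun x => by
      simpa using (((hasDerivAt_id x).sub_const a).const_mul (1 / 4 : ℝ)).const_sub (1 / 2 : ℝ))
    (fun x hx hxe => by
      have hx0 : 0 < x := ha.trans_le hx.1
      have hHx := hpos x hx0
      have h2 : 2 ≤ H x := by
        have : (H x)⁻¹ ≤ 2⁻¹ := by rw [hxe]; linarith [hx.1]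
        exact (inv_le_inv₀ hHx two_pos).1 this
      have h3 : c / x ≤ 1 / 2 := by
        rw [div_le_div_iff₀ hx0 two_pos]
        linarith [hx.1]
      rw [div_lt_iff₀ (by positivity)]
      have h1 := hH' x hx0
      have h4 : c / x * H x ≤ 1 / 2 * H x := by gcongr
      nlinarith)
  have h1 := key (right_mem_Icc.2 (by linarith))
  have h2 : 0 < (H (a + 2))⁻¹ := inv_pos.2 (hpos _ (by linarith))
  norm_num at h1
  linarith [inv_pos.1 h2]

/-- A positive global solution of the Riccati equation equals any solution bounded below
by `1`. -/
theorem riccati_solution_unique {c : ℝ} (hc : 0 ≤ c) {H H' h h' : ℝ → ℝ}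
    (hpos : ∀ r, 0 < r → 0 < H r) (hH : ∀ r, 0 < r → HasDerivAt H (H' r) r)
    (hH' : ∀ r, 0 < r → H' r + c / r * H r = -1 + H r ^ 2)
    (hh : ∀ r, 0 < r → HasDerivAt h (h' r) r)
    (hh' : ∀ r, 0 < r → h' r + c / r * h r = -1 + h r ^ 2)
    (hh1 : ∀ r, 0 < r → 1 ≤ h r) {r : ℝ} (hr : 0 < r) : H r = h r := by
  refine le_antisymm
    (riccati_supersolution_le hc hH (fun x hx => (hH' x hx).ge) hh hh' hh1 hr) ?_
  by_contra! hlt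
  have hD : ∀ x, 0 < x → HasDerivAt (fun x => h x - H x) (h' x - H' x) x :=
    fun x hx => (hh x hx).sub (hH x hx)
  have hge : ∀ x, 0 < x → h' x - H' x = (H x + h x - c / x) * (h x - H x) := by
    intro x hx
    linarith [hH' x hx, hh' x hx]
  -- The growth factor `H + h - c/x` exceeds `1 - c/x` because `H > 0` and `h ≥ 1`.
  have hstrict : ∀ x k : ℝ, 0 < x → k < 1 - c / x → 0 < h x - H x →
      k * (h x - H x) < h' x - H' x := by
    intro x k hx hk hx0
    rw [hge x hx]
    exact mul_lt_mul_of_pos_right (by linarith [hpos x hx, hh1 x hx]) hx0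
  have hDpos : ∀ x, r ≤ x → 0 < h x - H x := by
    intro x hx
    have := mul_exp_le_of_mul_lt_hasDerivAt (D := fun x => h x - H x) (k := -(c / r))
      (a := r) (by simpa using hlt) (fun y hy => hD y (hr.trans_le hy))
      (fun y hy hy0 => hstrict y _ (hr.trans_le hy) (by
        have h0 : 0 < y := hr.trans_le hy
        have h1 : c / y ≤ c / r := by gcongr
        linarith) hy0) hx
    refine lt_of_lt_of_le ?_ this
    have : 0 < h r - H r := by linarith
    positivity
  set a := max r (2 * c) with ha
  have ha0 : 0 < a := hr.trans_le (le_max_left _ _)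
  have hDa := hDpos a (le_max_left _ _)
  -- Far enough that growth at rate `1/4` makes `h - H` exceed `2`, by `exp z ≥ 1 + z`; this
  -- contradicts `H > 0` and `h ≤ 2`.
  set x := a + 4 * (2 / (h a - H a)) with hx
  have hax : a ≤ x := by
    have : 0 < 4 * (2 / (h a - H a)) := by positivity
    linarith
  have h1 := mul_exp_le_of_mul_lt_hasDerivAt (D := fun x => h x - H x) (k := 1 / 4)
      hDa (fun y hy => hD y (ha0.trans_le hy))
      (fun y hy hy0 => hstrict y _ (ha0.trans_le hy) (by
        have h0 : 0 < y := ha0.trans_le hy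
        have h1 : c / y ≤ 1 / 2 := by
          rw [div_le_div_iff₀ h0 two_pos]
          linarith [(le_max_right r (2 * c)).trans hy]
        linarith) hy0) hax
  have h2 : h x ≤ 2 := riccati_solution_le_two (fun y hy => one_pos.trans_le (hh1 y hy)) hh hh'
    (ha0.trans_le hax) ((le_max_right _ _).trans hax)
  have h3 := hpos x (ha0.trans_le hax)
  have h4 : 1 / 4 * (x - a) + 1 ≤ Real.exp (1 / 4 * (x - a)) := Real.add_one_le_exp _
  have h5 : 1 / 4 * (x - a) = 2 / (h a - H a) := by rw [hx]; ring
  have h6 : (h a - H a) * (2 / (h a - H a) + 1) = 2 + (h a - H a) := by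
    field_simp
  rw [h5] at h4
  simp only [h5] at h1
  nlinarith [mul_le_mul_of_nonneg_left h4 hDa.le]

/-! ### The modified Bessel function of the second kind -/

/-- Since `cosh s ≥ s²/4`, completing the square bounds the integrand by `exp((c+1)²/r) · exp(-s)`.
-/
theorem integrableOn_exp_neg_mul_cosh_mul_exp {r : ℝ} (hr : 0 < r) (c : ℝ) :
    IntegrableOn (fun s => Real.exp (-r * Real.cosh s) * Real.exp (c * s)) (Ioi 0) := by
  refine integrable_of_isBigO_exp_neg one_pos (Continuous.continuousOn (by fun_prop)) ?_
  refine Asymptotics.IsBigO.of_bound (Real.exp ((c + 1) ^ 2 / r)) ?_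
  filter_upwards [Filter.eventually_ge_atTop 0] with s hs
  rw [Real.norm_of_nonneg (by positivity), Real.norm_of_nonneg (by positivity),
    ← Real.exp_add, ← Real.exp_add, Real.exp_le_exp]
  have h1 : s ^ 2 / 4 ≤ Real.cosh s := by
    have h2 := Real.quadratic_le_exp_of_nonneg hs
    have h3 := Real.exp_pos (-s)
    rw [Real.cosh_eq]
    nlinarith
  have h4 : r * (s ^ 2 / 4) ≤ r * Real.cosh s := by gcongr
  have h5 : (c + 1) * s ≤ (c + 1) ^ 2 / r + r * (s ^ 2 / 4) := by
    have : (c + 1) ^ 2 / r + r * (s ^ 2 / 4) - (c + 1) * s = ((c + 1) - r * s / 2) ^ 2 / r := by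
      field_simp
      ring
    have h6 : 0 ≤ ((c + 1) - r * s / 2) ^ 2 / r := by positivity
    linarith
  linarith

theorem integrableOn_exp_neg_mul_cosh_mul_cosh {r : ℝ} (hr : 0 < r) (ν : ℝ) :
    IntegrableOn (fun s => Real.exp (-r * Real.cosh s) * Real.cosh (ν * s)) (Ioi 0) := by
  have h := ((integrableOn_exp_neg_mul_cosh_mul_exp hr ν).add
    (integrableOn_exp_neg_mul_cosh_mul_exp hr (-ν))).const_mul (1 / 2)
  refine h.congr (Filter.Eventually.of_forall fun s => ?_)
  simp only [Pi.add_apply, Real.cosh_eq (ν * s), neg_mul]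
  ring

theorem besselK_pos {r : ℝ} (hr : 0 < r) (ν : ℝ) : 0 < besselK ν r := by
  unfold besselK
  refine (setIntegral_pos_iff_support_of_nonneg_ae ?_
    (integrableOn_exp_neg_mul_cosh_mul_cosh hr ν)).2 ?_
  · exact Filter.Eventually.of_forall fun s =>
      (mul_pos (Real.exp_pos _) (Real.cosh_pos _)).le
  · have : Function.support (fun s => Real.exp (-r * Real.cosh s) * Real.cosh (ν * s)) = univ :=
      eq_univ_of_forall fun s => (mul_pos (Real.exp_pos _) (Real.cosh_pos _)).ne'
    rw [this, univ_inter, Real.volume_Ioi]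
    exact ENNReal.zero_lt_top

theorem besselK_le_besselK {r : ℝ} (hr : 0 < r) {μ ν : ℝ} (h : |μ| ≤ |ν|) :
    besselK μ r ≤ besselK ν r := by
  refine setIntegral_mono (integrableOn_exp_neg_mul_cosh_mul_cosh hr μ)
    (integrableOn_exp_neg_mul_cosh_mul_cosh hr ν) fun s => ?_
  refine mul_le_mul_of_nonneg_left (Real.cosh_le_cosh.2 ?_) (Real.exp_pos _).le
  rw [abs_mul, abs_mul]
  gcongr

/-- Differentiation under the integral brings down `-cosh s`, and the product formula for `cosh s
cosh(νs)` shifts the order by `±1`. For `x > r/2` the integrand at `r/2` dominates. -/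
theorem hasDerivAt_besselK {r : ℝ} (hr : 0 < r) (ν : ℝ) :
    HasDerivAt (besselK ν) (-(besselK (ν + 1) r + besselK (ν - 1) r) / 2) r := by
  have hcosh : ∀ s, Real.cosh ((ν + 1) * s) + Real.cosh ((ν - 1) * s)
      = 2 * (Real.cosh s * Real.cosh (ν * s)) := by
    intro s
    rw [show (ν + 1) * s = ν * s + s by ring, show (ν - 1) * s = ν * s - s by ring,
      Real.cosh_add, Real.cosh_sub]
    ring
  have hint : ∀ x, 0 < x → IntegrableOn
      (fun s => -(Real.exp (-x * Real.cosh s) * (Real.cosh s * Real.cosh (ν * s)))) (Ioi 0) := by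
    intro x hx
    refine (((integrableOn_exp_neg_mul_cosh_mul_cosh hx (ν + 1)).add
      (integrableOn_exp_neg_mul_cosh_mul_cosh hx (ν - 1))).const_mul (-(1 / 2))).congr
      (Filter.Eventually.of_forall fun s => ?_)
    simp only [Pi.add_apply, ← mul_add, hcosh]
    ring
  have key := (hasDerivAt_integral_of_dominated_loc_of_deriv_le
    (μ := volume.restrict (Ioi (0 : ℝ))) (x₀ := r) (s := Ioi (r / 2))
    (F := fun x s => Real.exp (-x * Real.cosh s) * Real.cosh (ν * s))
    (F' := fun x s => -(Real.exp (-x * Real.cosh s) * (Real.cosh s * Real.cosh (ν * s))))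
    (bound := fun s => Real.exp (-(r / 2) * Real.cosh s) * (Real.cosh s * Real.cosh (ν * s)))
    (Ioi_mem_nhds (by linarith))
    (Filter.Eventually.of_forall fun x => Continuous.aestronglyMeasurable (by fun_prop))
    (integrableOn_exp_neg_mul_cosh_mul_cosh hr ν)
    (Continuous.aestronglyMeasurable (by fun_prop))
    (Filter.Eventually.of_forall fun s x hx => by
      have h1 := Real.cosh_pos s
      have h2 := Real.cosh_pos (ν * s)
      rw [norm_neg, Real.norm_of_nonneg (by positivity)]
      have : r / 2 ≤ x := (mem_Ioi.1 hx).le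
      gcongr)
    (by simpa [IntegrableOn] using (hint (r / 2) (by linarith)).neg)
    (Filter.Eventually.of_forall fun s x _ => by
      have h1 : HasDerivAt (fun x : ℝ => -x * Real.cosh s) (-Real.cosh s) x := by
        simpa using (hasDerivAt_id x).neg.mul_const (Real.cosh s)
      exact (h1.exp.mul_const (Real.cosh (ν * s))).congr_deriv (by ring))).2
  refine key.congr_deriv ?_
  symm
  unfold besselK
  rw [← integral_add (integrableOn_exp_neg_mul_cosh_mul_cosh hr (ν + 1))
    (integrableOn_exp_neg_mul_cosh_mul_cosh hr (ν - 1)), ← integral_neg, ← integral_div]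
  refine integral_congr_ae (Filter.Eventually.of_forall fun s => ?_)
  simp only [← mul_add, hcosh]
  ring

/-- Integration by parts: `exp(-r cosh s) sinh(νs)` vanishes at `0` and at infinity, so its
derivative has zero integral. -/
theorem besselK_add_one_sub {r : ℝ} (hr : 0 < r) (ν : ℝ) :
    besselK (ν + 1) r - besselK (ν - 1) r = 2 * ν / r * besselK ν r := by
  have hsinh : ∀ s, Real.cosh ((ν + 1) * s) - Real.cosh ((ν - 1) * s)
      = 2 * (Real.sinh s * Real.sinh (ν * s)) := by
    intro s
    rw [show (ν + 1) * s = ν * s + s by ring, show (ν - 1) * s = ν * s - s by ring,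
      Real.cosh_add, Real.cosh_sub]
    ring
  have hi1 := integrableOn_exp_neg_mul_cosh_mul_cosh hr (ν + 1)
  have hi2 := integrableOn_exp_neg_mul_cosh_mul_cosh hr (ν - 1)
  have hi3 := integrableOn_exp_neg_mul_cosh_mul_cosh hr ν
  have hderiv : ∀ s ∈ Ici (0 : ℝ),
      HasDerivAt (fun s => Real.exp (-r * Real.cosh s) * Real.sinh (ν * s))
        (-(r / 2) * (Real.exp (-r * Real.cosh s) * Real.cosh ((ν + 1) * s)
          - Real.exp (-r * Real.cosh s) * Real.cosh ((ν - 1) * s))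
          + ν * (Real.exp (-r * Real.cosh s) * Real.cosh (ν * s))) s := by
    intro s _
    have h1 : HasDerivAt (fun s => -r * Real.cosh s) (-r * Real.sinh s) s :=
      (Real.hasDerivAt_cosh s).const_mul (-r)
    have h2 : HasDerivAt (fun s => Real.sinh (ν * s)) (Real.cosh (ν * s) * ν) s := by
      simpa using ((hasDerivAt_id s).const_mul ν).sinh
    refine (h1.exp.mul h2).congr_deriv ?_
    rw [← mul_sub, hsinh]
    ring
  have hint' : IntegrableOn (fun s =>
      -(r / 2) * (Real.exp (-r * Real.cosh s) * Real.cosh ((ν + 1) * s)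
          - Real.exp (-r * Real.cosh s) * Real.cosh ((ν - 1) * s))
          + ν * (Real.exp (-r * Real.cosh s) * Real.cosh (ν * s))) (Ioi 0) :=
    ((hi1.sub hi2).const_mul (-(r / 2))).add (hi3.const_mul ν)
  -- An integrable function with integrable derivative tends to zero, so no decay estimate is
  -- needed.
  have hlim : Filter.Tendsto (fun s => Real.exp (-r * Real.cosh s) * Real.sinh (ν * s))
      Filter.atTop (nhds 0) := by
    have hint : IntegrableOn (fun s => Real.exp (-r * Real.cosh s) * Real.sinh (ν * s))
        (Ioi 0) := by
      refine (((integrableOn_exp_neg_mul_cosh_mul_exp hr ν).sub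
        (integrableOn_exp_neg_mul_cosh_mul_exp hr (-ν))).const_mul (1 / 2)).congr
        (Filter.Eventually.of_forall fun s => ?_)
      simp only [Pi.sub_apply, Real.sinh_eq (ν * s), neg_mul]
      ring
    exact tendsto_zero_of_hasDerivAt_of_integrableOn_Ioi
      (fun s hs => hderiv s (Ioi_subset_Ici_self hs)) hint' hint
  have key := integral_Ioi_of_hasDerivAt_of_tendsto' hderiv hint' hlim
  have hi4 : IntegrableOn (fun s =>
      -(r / 2) * (Real.exp (-r * Real.cosh s) * Real.cosh ((ν + 1) * s)
          - Real.exp (-r * Real.cosh s) * Real.cosh ((ν - 1) * s))) (Ioi 0) :=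
    (hi1.sub hi2).const_mul _
  rw [integral_add hi4 (hi3.const_mul _), integral_const_mul,
    integral_const_mul, integral_sub hi1 hi2] at key
  simp only [mul_zero, Real.sinh_zero, sub_self] at key
  change -(r / 2) * (besselK (ν + 1) r - besselK (ν - 1) r) + ν * besselK ν r = 0 at key
  field_simp
  linarith

theorem one_le_hN {N : ℕ} (hN2 : 2 ≤ N) {r : ℝ} (hr : 0 < r) : 1 ≤ hN N r := by
  have h2 : (2 : ℝ) ≤ N := by exact_mod_cast hN2
  rw [hN, one_le_div (besselK_pos hr _)]
  refine besselK_le_besselK hr ?_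
  rw [abs_of_nonneg (by linarith), abs_of_nonneg (by linarith)]
  linarith

/-- The recurrence at orders `N/2` and `N/2 - 1` eliminates all Bessel functions from the quotient
rule except `K_{N/2}` and `K_{N/2-1}`. -/
theorem hasDerivAt_hN (N : ℕ) {r : ℝ} (hr : 0 < r) :
    HasDerivAt (hN N) (-1 + hN N r ^ 2 - ((N : ℝ) - 1) / r * hN N r) r := by
  have hpos := besselK_pos hr ((N : ℝ) / 2 - 1)
  have h1 := hasDerivAt_besselK hr ((N : ℝ) / 2)
  have h2 := hasDerivAt_besselK hr ((N : ℝ) / 2 - 1)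
  have h3 := besselK_add_one_sub hr ((N : ℝ) / 2)
  have h4 := besselK_add_one_sub hr ((N : ℝ) / 2 - 1)
  rw [sub_add_cancel] at h2 h4
  refine (h1.div h2 hpos.ne').congr_deriv ?_
  have h3' : besselK ((N : ℝ) / 2 + 1) r = besselK ((N : ℝ) / 2 - 1) r
      + 2 * ((N : ℝ) / 2) / r * besselK ((N : ℝ) / 2) r := by linarith
  have h4' : besselK ((N : ℝ) / 2 - 1 - 1) r = besselK ((N : ℝ) / 2) r
      - 2 * ((N : ℝ) / 2 - 1) / r * besselK ((N : ℝ) / 2 - 1) r := by linarith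
  rw [h3', h4', hN]
  generalize besselK ((N : ℝ) / 2 - 1) r = b at hpos
  generalize besselK ((N : ℝ) / 2) r = a
  field_simp
  ring

theorem isPositiveRiccatiSolution_hN {N : ℕ} (hN2 : 2 ≤ N) :
    IsPositiveRiccatiSolution N (hN N) := by
  intro r hr
  refine ⟨one_pos.trans_le (one_le_hN hN2 hr), (hasDerivAt_hN N hr).differentiableAt, ?_⟩
  rw [(hasDerivAt_hN N hr).deriv]
  ring

theorem IsPositiveRiccatiSolution.eq_hN {N : ℕ} (hN2 : 2 ≤ N) {H : ℝ → ℝ}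
    (hH : IsPositiveRiccatiSolution N H) {r : ℝ} (hr : 0 < r) : H r = hN N r := by
  have h2 : (2 : ℝ) ≤ N := by exact_mod_cast hN2
  exact riccati_solution_unique (c := (N : ℝ) - 1) (by linarith) (fun x hx => (hH x hx).1)
    (fun x hx => (hH x hx).2.1.hasDerivAt) (fun x hx => (hH x hx).2.2)
    (fun x hx => hasDerivAt_hN N hx) (fun x _ => by ring) (fun x hx => one_le_hN hN2 hx) hr

/-! ### Weak derivatives on the half-line -/

/-- A smooth function supported in `[a, b]` with zero integral is the derivative of a smooth
function supported in `[a, b]`. -/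
theorem exists_deriv_eq_of_integral_eq_zero {g : ℝ → ℝ} (hg : ContDiff ℝ ∞ g) {a b : ℝ}
    (hsupp : ∀ x, x ∉ Icc a b → g x = 0) (hint : ∫ x, g x = 0) :
    ∃ ψ : ℝ → ℝ, ContDiff ℝ ∞ ψ ∧ tsupport ψ ⊆ Icc a b ∧ ∀ x, deriv ψ x = g x := by
  have hder : ∀ x, HasDerivAt (fun x => ∫ s in a..x, g s) (g x) x := fun x =>
    intervalIntegral.integral_hasDerivAt_right (hg.continuous.intervalIntegrable _ _)
      (hg.continuous.stronglyMeasurableAtFilter _ _) hg.continuous.continuousAt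
  have hderiv : deriv (fun x => ∫ s in a..x, g s) = g := funext fun x => (hder x).deriv
  refine ⟨fun x => ∫ s in a..x, g s, ?_, ?_, fun x => congrFun hderiv x⟩
  · rw [contDiff_infty_iff_deriv, hderiv]
    exact ⟨fun x => (hder x).differentiableAt, hg⟩
  · refine closure_minimal (fun x hx => ?_) isClosed_Icc
    by_contra hxI
    refine hx ?_
    rcases lt_or_ge x a with hxa | hxa
    · change ∫ s in a..x, g s = 0
      rw [intervalIntegral.integral_symm, neg_eq_zero, intervalIntegral.integral_of_le hxa.le,
        ← integral_Icc_eq_integral_Ioc, integral_Icc_eq_integral_Ico]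
      exact setIntegral_eq_zero_of_forall_eq_zero fun s hs => hsupp s fun h => not_lt.2 h.1 hs.2
    · have hbx : b < x := by
        by_contra! h
        exact hxI ⟨hxa, h⟩
      change ∫ s in a..x, g s = 0
      rw [intervalIntegral.integral_of_le hxa, ← integral_Icc_eq_integral_Ioc,
        setIntegral_eq_integral_of_forall_compl_eq_zero, hint]
      intro s hs
      exact hsupp s fun h => hs ⟨h.1, h.2.trans hbx.le⟩

/-- A continuous function on the half-line whose weak derivative vanishes is constant. -/
theorem exists_eqOn_const_of_integral_mul_deriv_eq_zero {G : ℝ → ℝ} (hG : Continuous G)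
    (h : ∀ ψ : ℝ → ℝ, ContDiff ℝ ∞ ψ → HasCompactSupport ψ → tsupport ψ ⊆ Ioi 0 →
      ∫ x, G x * deriv ψ x = 0) : ∃ c, ∀ x, 0 < x → G x = c := by
  -- Du Bois-Reymond argument: for a unit-mass bump `θ` supported in `(0, ∞)` and any test function
  -- `g`, the function `g - (∫ g) θ` has zero mean, so it is the derivative of a test function. The
  -- constant is then `∫ G θ`.
  let θ₀ : ContDiffBump (1 : ℝ) := ⟨1 / 4, 1 / 2, by norm_num, by norm_num⟩
  let θ : ℝ → ℝ := θ₀.normed volume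
  have hθ : ContDiff ℝ ∞ θ := θ₀.contDiff_normed
  have hθc : HasCompactSupport θ := θ₀.hasCompactSupport_normed
  have hθs : tsupport θ = Metric.closedBall 1 (1 / 2) := θ₀.tsupport_normed_eq
  have hθi : ∫ x, θ x = 1 := θ₀.integral_normed
  have key : ∀ᵐ x, x ∈ Ioi (0 : ℝ) → G x - ∫ y, G y * θ y = 0 := by
    refine isOpen_Ioi.ae_eq_zero_of_integral_contDiff_smul_eq_zero
      ((hG.sub continuous_const).locallyIntegrable.locallyIntegrableOn _) fun g hg hgc hgs => ?_
    set I := ∫ x, g x with hI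
    have hK : IsCompact (tsupport g ∪ tsupport θ) := hgc.isCompact.union hθc.isCompact
    have hKne : (tsupport g ∪ tsupport θ).Nonempty :=
      ⟨1, Or.inr (by rw [hθs]; exact Metric.mem_closedBall_self (by norm_num))⟩
    obtain ⟨a, ha⟩ := hK.exists_isLeast hKne
    obtain ⟨b, hb⟩ := hK.exists_isGreatest hKne
    have ha0 : 0 < a := by
      rcases ha.1 with h1 | h1
      · exact hgs h1
      · rw [hθs, Real.closedBall_eq_Icc] at h1
        linarith [h1.1]
    have hgi : Integrable g := hg.continuous.integrable_of_hasCompactSupport hgc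
    have hθint : Integrable θ := hθ.continuous.integrable_of_hasCompactSupport hθc
    obtain ⟨ψ, hψ, hψs, hψd⟩ := exists_deriv_eq_of_integral_eq_zero (g := fun x => g x - I * θ x)
      (a := a) (b := b) (hg.sub (contDiff_const.mul hθ))
      (fun x hx => by
        have hx' : x ∉ tsupport g ∪ tsupport θ := fun h => hx ⟨ha.2 h, hb.2 h⟩
        have h1 : g x = 0 := image_eq_zero_of_notMem_tsupport fun h => hx' (Or.inl h)
        have h2 : θ x = 0 := image_eq_zero_of_notMem_tsupport fun h => hx' (Or.inr h)
        simp [h1, h2])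
      (by rw [integral_sub hgi (hθint.const_mul I), integral_const_mul, hθi]; simp [hI])
    have h0 := h ψ hψ (HasCompactSupport.of_support_subset_isCompact isCompact_Icc
      ((subset_tsupport ψ).trans hψs)) (hψs.trans fun x hx => ha0.trans_le hx.1)
    have hGg : Integrable (fun x => g x * G x) :=
      (hg.continuous.mul hG).integrable_of_hasCompactSupport hgc.mul_right
    have hGθ : Integrable (fun x => G x * θ x) :=
      (hG.mul hθ.continuous).integrable_of_hasCompactSupport hθc.mul_left
    have h1 : ∫ x, G x * deriv ψ x = (∫ x, g x * G x) - I * ∫ x, G x * θ x := by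
      rw [← integral_const_mul, ← integral_sub hGg (hGθ.const_mul I)]
      refine integral_congr_ae (Filter.Eventually.of_forall fun x => ?_)
      simp only [hψd]
      ring
    have h2 : ∫ x, g x • (G x - ∫ y, G y * θ y) = (∫ x, g x * G x) - I * ∫ x, G x * θ x := by
      rw [hI, ← integral_mul_const, ← integral_sub hGg (hgi.mul_const _)]
      refine integral_congr_ae (Filter.Eventually.of_forall fun x => ?_)
      simp only [smul_eq_mul]
      ring
    rw [h2, ← h1, h0]
  refine ⟨∫ y, G y * θ y, fun x hx => ?_⟩
  have := Measure.eqOn_open_of_ae_eq (μ := (volume : Measure ℝ)) (U := Ioi (0 : ℝ)) (f := G)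
    (g := fun _ => ∫ y, G y * θ y)
    ((ae_restrict_iff' measurableSet_Ioi).2 (key.mono fun x hx h => sub_eq_zero.1 (hx h)))
    isOpen_Ioi hG.continuousOn continuousOn_const
  exact this hx

/-- If the continuous function `B` is the weak derivative of the continuous function `A` on the
half-line, then it is its derivative. -/
theorem hasDerivAt_of_integral_mul_deriv_add_eq_zero {A B : ℝ → ℝ} (hA : Continuous A)
    (hB : Continuous B)
    (h : ∀ ψ : ℝ → ℝ, ContDiff ℝ ∞ ψ → HasCompactSupport ψ → tsupport ψ ⊆ Ioi 0 →
      ∫ x, (A x * deriv ψ x + B x * ψ x) = 0) {r : ℝ} (hr : 0 < r) : HasDerivAt A (B r) r := by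
  have hP : ∀ x, HasDerivAt (fun x => ∫ s in (0 : ℝ)..x, B s) (B x) x := fun x =>
    intervalIntegral.integral_hasDerivAt_right (hB.intervalIntegrable _ _)
      (hB.stronglyMeasurableAtFilter _ _) hB.continuousAt
  -- `P` is a classical primitive of `B`, so `A - P` has zero weak derivative and is constant.
  set P : ℝ → ℝ := fun x => ∫ s in (0 : ℝ)..x, B s with hPdef
  have hPc : Continuous P := continuous_iff_continuousAt.2 fun x => (hP x).continuousAt
  obtain ⟨c, hc⟩ := exists_eqOn_const_of_integral_mul_deriv_eq_zero (G := fun x => A x - P x)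
    (hA.sub hPc) fun ψ hψ hψc hψs => by
      have hd : Continuous (deriv ψ) := hψ.continuous_deriv (by simp)
      have hdc : HasCompactSupport (deriv ψ) := hψc.deriv
      have hi1 : Integrable fun x => A x * deriv ψ x + B x * ψ x :=
        ((hA.mul hd).integrable_of_hasCompactSupport hdc.mul_left).add
          ((hB.mul hψ.continuous).integrable_of_hasCompactSupport hψc.mul_left)
      have hi2 : Integrable fun x => B x * ψ x + P x * deriv ψ x :=
        ((hB.mul hψ.continuous).integrable_of_hasCompactSupport hψc.mul_left).add
          ((hPc.mul hd).integrable_of_hasCompactSupport hdc.mul_left)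
      have hi3 : Integrable fun x => P x * ψ x :=
        (hPc.mul hψ.continuous).integrable_of_hasCompactSupport hψc.mul_left
      have h2 : ∫ x, (B x * ψ x + P x * deriv ψ x) = 0 :=
        integral_eq_zero_of_hasDerivAt_of_integrable
          (fun x => (hP x).mul (hψ.differentiable (by simp) x).hasDerivAt) hi2 hi3
      have h3 := integral_sub hi1 hi2
      rw [h ψ hψ hψc hψs, h2, sub_zero] at h3
      rw [← h3]
      refine integral_congr_ae (Filter.Eventually.of_forall fun x => ?_)
      simp only
      ring
  refine ((hP r).add_const c).congr_of_eventuallyEq ?_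
  filter_upwards [Ioi_mem_nhds hr] with x hx
  linarith [hc x hx]

/-! ### Polar coordinates -/

/-- Off the null set `{0}`, the measure is the product of the sphere measure and `r^{n-1} dr`; the
rest is Fubini. -/
theorem integral_eq_integral_Ioi_pow_mul_integral_toSphere {E : Type*} [NormedAddCommGroup E]
    [NormedSpace ℝ E] [MeasurableSpace E] [BorelSpace E] [FiniteDimensional ℝ E] [Nontrivial E]
    (μ : Measure E) [μ.IsAddHaarMeasure] {g : E → ℝ} (hg : Integrable g μ) :
    ∫ x, g x ∂μ = ∫ r in Ioi (0 : ℝ), r ^ (Module.finrank ℝ E - 1) *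
      ∫ θ : Metric.sphere (0 : E) 1, g (r • (θ : E)) ∂μ.toSphere := by
  have hmp := μ.measurePreserving_homeomorphUnitSphereProd
  have hemb := (homeomorphUnitSphereProd E).measurableEmbedding
  have hcomp : ∀ x : ({0}ᶜ : Set E),
      g (((homeomorphUnitSphereProd E x).2 : ℝ) • ((homeomorphUnitSphereProd E x).1 : E))
        = g x := by
    intro x
    congr 1
    have hx : ‖(x : E)‖ ≠ 0 := norm_ne_zero_iff.2 x.2
    simp [smul_smul, hx]
  have hint : Integrable (fun p : Metric.sphere (0 : E) 1 × Ioi (0 : ℝ) =>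
      g ((p.2 : ℝ) • (p.1 : E))) (μ.toSphere.prod (.volumeIoiPow (Module.finrank ℝ E - 1))) := by
    rw [← hmp.integrable_comp_emb hemb]
    simp only [Function.comp_def, hcomp]
    rw [← restrict_compl_singleton (μ := μ) 0, ← IntegrableOn,
      integrableOn_iff_comap_subtypeVal (by measurability)] at hg
    exact hg
  calc
    ∫ x, g x ∂μ = ∫ x : ({0}ᶜ : Set E), g x ∂(μ.comap (↑)) := by
      rw [integral_subtype_comap (measurableSet_singleton _).compl, restrict_compl_singleton]
    _ = ∫ p : Metric.sphere (0 : E) 1 × Ioi (0 : ℝ), g ((p.2 : ℝ) • (p.1 : E))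
        ∂(μ.toSphere.prod (.volumeIoiPow (Module.finrank ℝ E - 1))) := by
      rw [← hmp.integral_comp hemb]
      simp only [hcomp]
    _ = ∫ r : Ioi (0 : ℝ), ∫ θ : Metric.sphere (0 : E) 1, g ((r : ℝ) • (θ : E)) ∂μ.toSphere
        ∂(.volumeIoiPow (Module.finrank ℝ E - 1)) := integral_prod_symm _ hint
    _ = _ := by
      simp only [Measure.volumeIoiPow, ENNReal.ofReal]
      rw [integral_withDensity_eq_integral_smul,
        integral_subtype_comap measurableSet_Ioi fun a ↦
          Real.toNNReal (a ^ (Module.finrank ℝ E - 1)) •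
            ∫ θ : Metric.sphere (0 : E) 1, g (a • (θ : E)) ∂μ.toSphere,
        setIntegral_congr_fun measurableSet_Ioi fun x hx ↦ ?_]
      · simp only [NNReal.smul_def, Real.coe_toNNReal _ (pow_nonneg (le_of_lt hx.out) _),
          smul_eq_mul]
      · exact (measurable_subtype_coe.pow_const _).real_toNNReal

/-- The mass is `N` times the volume of the unit ball, and `Γ(N/2 + 1) = (N/2) Γ(N/2)`. -/
theorem toSphere_real_univ_eq_omegaN {N : ℕ} (hN : N ≠ 0) :
    (volume : Measure (RN N)).toSphere.real univ = omegaN N := by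
  have : Nonempty (Fin N) := ⟨⟨0, Nat.pos_of_ne_zero hN⟩⟩
  have hN' : (N : ℝ) / 2 ≠ 0 := by positivity
  have hG : Real.Gamma ((N : ℝ) / 2) ≠ 0 :=
    (Real.Gamma_pos_of_pos (by positivity)).ne'
  rw [Measure.toSphere_real_apply_univ, Measure.real, EuclideanSpace.volume_ball, omegaN,
    ENNReal.toReal_mul, ENNReal.toReal_ofReal (by positivity), finrank_euclideanSpace,
    Fintype.card_fin, Real.Gamma_add_one hN', Real.sqrt_eq_rpow, ← Real.rpow_natCast,
    ← Real.rpow_mul Real.pi_pos.le]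
  simp only [ENNReal.ofReal_one, one_pow, ENNReal.toReal_one, one_mul]
  rw [show (1 : ℝ) / 2 * (N : ℝ) = (N : ℝ) / 2 by ring]
  field_simp

/-! ### Radial test functions -/

/-- The support condition makes `χ(|x|)` vanish near the origin, the only point where the norm is
not smooth. -/
theorem hasFDerivAt_comp_norm {E : Type*} [NormedAddCommGroup E] [InnerProductSpace ℝ E]
    {χ : ℝ → ℝ} (hχ : Differentiable ℝ χ) (hχs : tsupport χ ⊆ Ioi 0) (x : E) :
    HasFDerivAt (fun x : E => χ ‖x‖) ((deriv χ ‖x‖ * ‖x‖⁻¹) • innerSL ℝ x) x := by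
  rcases eq_or_ne x 0 with rfl | hx
  · have h0 : (0 : ℝ) ∉ tsupport χ := fun h => lt_irrefl (0 : ℝ) (hχs h)
    have h1 : (fun x : E => χ ‖x‖) =ᶠ[nhds 0] fun _ => 0 := by
      have : Filter.Tendsto (fun x : E => ‖x‖) (nhds 0) (nhds 0) := tendsto_norm_zero
      exact this.eventually (notMem_tsupport_iff_eventuallyEq.1 h0)
    simpa using (hasFDerivAt_const (0 : ℝ) (0 : E)).congr_of_eventuallyEq h1
  · have hx' : ‖x‖ ≠ 0 := norm_ne_zero_iff.2 hx
    have h1 : HasFDerivAt (fun x : E => ‖x‖) (‖x‖⁻¹ • innerSL ℝ x) x := by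
      have h2 := (hasStrictFDerivAt_norm_sq x).hasFDerivAt.sqrt (by positivity)
      have h3 : (fun x : E => √(‖x‖ ^ 2)) = fun x => ‖x‖ :=
        funext fun y => Real.sqrt_sq (norm_nonneg y)
      rw [h3, Real.sqrt_sq (norm_nonneg x)] at h2
      refine h2.congr_fderiv ?_
      ext v
      simp
      field_simp
    refine ((hχ ‖x‖).hasDerivAt.comp_hasFDerivAt x h1).congr_fderiv ?_
    rw [smul_smul]

theorem contDiff_comp_norm {E : Type*} [NormedAddCommGroup E] [InnerProductSpace ℝ E]
    {χ : ℝ → ℝ} (hχ : ContDiff ℝ ∞ χ) (hχs : tsupport χ ⊆ Ioi 0) :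
    ContDiff ℝ ∞ (fun x : E => χ ‖x‖) := by
  refine contDiff_iff_contDiffAt.2 fun x => ?_
  rcases eq_or_ne x 0 with rfl | hx
  · have h0 : (0 : ℝ) ∉ tsupport χ := fun h => lt_irrefl (0 : ℝ) (hχs h)
    have h1 : (fun x : E => χ ‖x‖) =ᶠ[nhds 0] fun _ => 0 := by
      have : Filter.Tendsto (fun x : E => ‖x‖) (nhds 0) (nhds 0) := tendsto_norm_zero
      exact this.eventually (notMem_tsupport_iff_eventuallyEq.1 h0)
    exact contDiffAt_const.congr_of_eventuallyEq h1
  · exact hχ.contDiffAt.comp x (contDiffAt_norm ℝ hx)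

theorem isTestFunction_mul {N : ℕ} {χ ψ : ℝ → ℝ} (hχ : ContDiff ℝ ∞ χ)
    (hχc : HasCompactSupport χ) (hχs : tsupport χ ⊆ Ioi 0) (hψ : ContDiff ℝ ∞ ψ)
    (hψc : HasCompactSupport ψ) (hψs : tsupport ψ ⊆ Ioi 0) :
    IsTestFunction (fun p : RN N × ℝ => χ ‖p.1‖ * ψ p.2) := by
  obtain ⟨M, hM⟩ := hχc.isCompact.bddAbove
  have hsub : Function.support (fun p : RN N × ℝ => χ ‖p.1‖ * ψ p.2)
      ⊆ Metric.closedBall 0 M ×ˢ tsupport ψ := by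
    intro p hp
    refine ⟨?_, subset_tsupport _ (right_ne_zero_of_mul hp)⟩
    rw [mem_closedBall_zero_iff]
    exact hM (subset_tsupport _ (left_ne_zero_of_mul hp))
  have hK : IsCompact (Metric.closedBall (0 : RN N) M ×ˢ tsupport ψ) :=
    (isCompact_closedBall _ _).prod hψc.isCompact
  refine ⟨?_, HasCompactSupport.of_support_subset_isCompact hK hsub, ?_⟩
  · exact ((contDiff_comp_norm hχ hχs).comp contDiff_fst).mul (hψ.comp contDiff_snd)
  · exact (closure_minimal hsub hK.isClosed).trans
      (prod_mono (subset_univ _) hψs)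

theorem fderiv_comp_norm_mul_apply {N : ℕ} {χ ψ : ℝ → ℝ} (hχ : Differentiable ℝ χ)
    (hχs : tsupport χ ⊆ Ioi 0) (hψ : Differentiable ℝ ψ) (p : RN N × ℝ) (v : RN N) (s : ℝ) :
    fderiv ℝ (fun p : RN N × ℝ => χ ‖p.1‖ * ψ p.2) p (v, s)
      = χ ‖p.1‖ * deriv ψ p.2 * s + deriv χ ‖p.1‖ * inner ℝ v (‖p.1‖⁻¹ • p.1) * ψ p.2 := by
  have h1 : HasFDerivAt (fun p : RN N × ℝ => χ ‖p.1‖) _ p :=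
    (hasFDerivAt_comp_norm hχ hχs p.1).comp p hasFDerivAt_fst
  have h2 : HasFDerivAt (fun p : RN N × ℝ => ψ p.2) _ p :=
    (hψ p.2).hasDerivAt.comp_hasFDerivAt p
      (hasFDerivAt_snd (𝕜 := ℝ) (E := RN N) (F := ℝ) (p := p))
  have h3 : HasFDerivAt (fun p : RN N × ℝ => χ ‖p.1‖ * ψ p.2) _ p := h1.mul h2
  rw [h3.fderiv]
  simp [real_inner_smul_right, real_inner_comm v]
  ring

/-! ### Integrals depending on parameters -/

theorem continuous_integral_of_compactSpace {X Y : Type*} [TopologicalSpace X]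
    [FirstCountableTopology X] [LocallyCompactSpace X] [TopologicalSpace Y] [CompactSpace Y]
    [MeasurableSpace Y] [OpensMeasurableSpace Y] (μ : Measure Y) [IsFiniteMeasure μ]
    {g : X → Y → ℝ} (hg : Continuous (Function.uncurry g)) :
    Continuous fun x => ∫ y, g x y ∂μ := by
  simpa using continuous_parametric_integral_of_continuous (μ := μ) hg isCompact_univ

theorem continuous_integral_of_forall_notMem_eq_zero {g : ℝ → ℝ → ℝ}
    (hg : Continuous (Function.uncurry g)) {K : Set ℝ} (hK : IsCompact K)
    (h0 : ∀ t r, r ∉ K → g t r = 0) : Continuous fun t => ∫ r, g t r := by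
  rw [← continuousOn_univ]
  exact continuousOn_integral_of_compact_support hK hg.continuousOn fun t r _ hr => h0 t r hr

theorem intervalIntegral_integral_comm_of_forall_notMem_eq_zero {g : ℝ → ℝ → ℝ}
    (hg : Continuous (Function.uncurry g)) {K : Set ℝ} (hK : IsCompact K)
    (h0 : ∀ t r, r ∉ K → g t r = 0) {T : ℝ} (hT : 0 ≤ T) :
    ∫ t in (0 : ℝ)..T, ∫ r, g t r = ∫ r, ∫ t in (0 : ℝ)..T, g t r := by
  simp only [intervalIntegral.integral_of_le hT]
  refine integral_integral_swap ?_
  have h1 : IntegrableOn (Function.uncurry g) (Icc 0 T ×ˢ K) :=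
    hg.continuousOn.integrableOn_compact (isCompact_Icc.prod hK)
  have h2 : IntegrableOn (Function.uncurry g) (Ioc 0 T ×ˢ K) :=
    h1.mono_set (prod_mono Ioc_subset_Icc_self subset_rfl)
  have h3 : IntegrableOn (Function.uncurry g) (Ioc 0 T ×ˢ univ) := by
    refine h2.of_forall_sdiff_eq_zero (measurableSet_Ioc.prod MeasurableSet.univ) ?_
    rintro ⟨t, r⟩ ⟨⟨ht, -⟩, hn⟩
    exact h0 t r fun hr => hn ⟨ht, hr⟩
  rwa [IntegrableOn, Measure.volume_eq_prod, ← Measure.prod_restrict, Measure.restrict_univ]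
    at h3

/-! ### Energy balance in polar coordinates -/

/-- This is the balance tested with `χ(|x|) ψ(t)` in polar coordinates. The gradient of a radial
function is radial, so only the component `f · θ` survives. -/
theorem EnergyBalance.integral_radial_eq_zero {N : ℕ} (hN : N ≠ 0) {e : ℝ → RN N → ℝ}
    {f : ℝ → RN N → RN N} {d : ℝ → RN N → ℝ} (he : Continuous (Function.uncurry e))
    (hf : Continuous (Function.uncurry f)) (hd : Continuous (Function.uncurry d))
    (h : EnergyBalance e f d) {χ ψ : ℝ → ℝ} (hχ : ContDiff ℝ ∞ χ)
    (hχc : HasCompactSupport χ) (hχs : tsupport χ ⊆ Ioi 0) (hψ : ContDiff ℝ ∞ ψ)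
    (hψc : HasCompactSupport ψ) (hψs : tsupport ψ ⊆ Ioi 0) :
    ∫ t, ((∫ r, r ^ (N - 1) * (∫ θ : Metric.sphere (0 : RN N) 1, e t (r • (θ : RN N))
          ∂(volume : Measure (RN N)).toSphere) * χ r) * deriv ψ t
      - (∫ r, r ^ (N - 1) * ((∫ θ : Metric.sphere (0 : RN N) 1,
            inner ℝ (f t (r • (θ : RN N))) (θ : RN N) ∂(volume : Measure (RN N)).toSphere)
            * deriv χ r
          + (∫ θ : Metric.sphere (0 : RN N) 1, d t (r • (θ : RN N))
            ∂(volume : Measure (RN N)).toSphere) * χ r)) * ψ t) = 0 := by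
  have : Nonempty (Fin N) := ⟨⟨0, Nat.pos_of_ne_zero hN⟩⟩
  set σ := (volume : Measure (RN N)).toSphere
  have hφ := isTestFunction_mul (N := N) hχ hχc hχs hψ hψc hψs
  have h0 := h _ hφ
  set φ : RN N × ℝ → ℝ := fun p => χ ‖p.1‖ * ψ p.2 with hφdef
  have hχd : Differentiable ℝ χ := hχ.differentiable (by simp)
  have hψd : Differentiable ℝ ψ := hψ.differentiable (by simp)
  have hdφ : Continuous (fderiv ℝ φ) := hφ.smooth.continuous_fderiv (by simp)
  have he' : Continuous fun p : RN N × ℝ => e p.2 p.1 := he.comp continuous_swap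
  have hf' : Continuous fun p : RN N × ℝ => f p.2 p.1 := hf.comp continuous_swap
  have hd' : Continuous fun p : RN N × ℝ => d p.2 p.1 := hd.comp continuous_swap
  set G : RN N × ℝ → ℝ := fun p => e p.2 p.1 * fderiv ℝ φ p (0, 1)
    - fderiv ℝ φ p (f p.2 p.1, 0) - d p.2 p.1 * φ p with hG
  have hGc : Continuous G := by
    refine ((he'.mul (hdφ.clm_apply continuous_const)).sub (hdφ.clm_apply ?_)).sub
      (hd'.mul hφ.smooth.continuous)
    exact hf'.prodMk continuous_const
  have hG0 : ∀ p, p ∉ tsupport φ → G p = 0 := by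
    intro p hp
    have h1 : φ p = 0 := image_eq_zero_of_notMem_tsupport hp
    have h2 : fderiv ℝ φ p = 0 := by
      by_contra h2
      exact hp (support_fderiv_subset ℝ h2)
    simp [hG, h1, h2]
  have hGi : Integrable G :=
    hGc.integrable_of_hasCompactSupport (HasCompactSupport.intro hφ.compact_support hG0)
  have hGt : ∀ t, Integrable fun x => G (x, t) := fun t =>
    (hGc.comp (by fun_prop : Continuous fun x : RN N => (x, t))).integrable_of_hasCompactSupport
      (HasCompactSupport.intro (hφ.compact_support.isCompact.image continuous_fst)
        fun x hx => hG0 _ fun hxt => hx ⟨(x, t), hxt, rfl⟩)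
  rw [Measure.volume_eq_prod, integral_prod_symm _ hGi] at h0
  rw [← h0]
  refine integral_congr_ae (Filter.Eventually.of_forall fun t => ?_)
  simp only
  rw [integral_eq_integral_Ioi_pow_mul_integral_toSphere volume (hGt t), finrank_euclideanSpace,
    Fintype.card_fin]
  have hsph : ∀ {g : RN N → ℝ} (_ : Continuous g) (r : ℝ),
      Integrable (fun θ : Metric.sphere (0 : RN N) 1 => g (r • (θ : RN N))) σ := by
    intro g hg r
    exact (hg.comp (by fun_prop :
      Continuous fun θ : Metric.sphere (0 : RN N) 1 => r • (θ : RN N)))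
        |>.integrable_of_hasCompactSupport (HasCompactSupport.of_compactSpace _)
  have het : Continuous (e t) := he.comp (by fun_prop : Continuous fun x : RN N => (t, x))
  have hdt : Continuous (d t) := hd.comp (by fun_prop : Continuous fun x : RN N => (t, x))
  have hft : Continuous (f t) := hf.comp (by fun_prop : Continuous fun x : RN N => (t, x))
  have hfs : ∀ r : ℝ, Integrable (fun θ : Metric.sphere (0 : RN N) 1 =>
      inner ℝ (f t (r • (θ : RN N))) (θ : RN N)) σ := by
    intro r
    refine Continuous.integrable_of_hasCompactSupport ?_ (HasCompactSupport.of_compactSpace _)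
    exact (hft.comp (by fun_prop)).inner continuous_subtype_val
  have hχ0 : ∀ r, r ∉ tsupport χ → χ r = 0 := fun r hr => image_eq_zero_of_notMem_tsupport hr
  have hχ0' : ∀ r, r ∉ tsupport χ → deriv χ r = 0 := fun r hr => by
    by_contra h2
    exact hr (support_deriv_subset h2)
  have hcE : Continuous fun r : ℝ => ∫ θ : Metric.sphere (0 : RN N) 1, e t (r • (θ : RN N)) ∂σ :=
    continuous_integral_of_compactSpace σ (het.comp (by fun_prop))
  have hcD : Continuous fun r : ℝ => ∫ θ : Metric.sphere (0 : RN N) 1, d t (r • (θ : RN N)) ∂σ :=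
    continuous_integral_of_compactSpace σ (hdt.comp (by fun_prop))
  have hcF : Continuous fun r : ℝ => ∫ θ : Metric.sphere (0 : RN N) 1,
      inner ℝ (f t (r • (θ : RN N))) (θ : RN N) ∂σ :=
    continuous_integral_of_compactSpace σ
      ((hft.comp (by fun_prop : Continuous fun p : ℝ × Metric.sphere (0 : RN N) 1 =>
        p.1 • (p.2 : RN N))).inner (by fun_prop))
  have hχ' : Continuous (deriv χ) := hχ.continuous_deriv (by simp)
  have hi1 : Integrable fun r => r ^ (N - 1) * (∫ θ : Metric.sphere (0 : RN N) 1,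
      e t (r • (θ : RN N)) ∂σ) * χ r :=
    (((continuous_pow _).mul hcE).mul hχ.continuous).integrable_of_hasCompactSupport
      hχc.mul_left
  have hi2 : Integrable fun r => r ^ (N - 1) * ((∫ θ : Metric.sphere (0 : RN N) 1,
      inner ℝ (f t (r • (θ : RN N))) (θ : RN N) ∂σ) * deriv χ r
      + (∫ θ : Metric.sphere (0 : RN N) 1, d t (r • (θ : RN N)) ∂σ) * χ r) :=
    ((continuous_pow _).mul ((hcF.mul hχ').add
      (hcD.mul hχ.continuous))).integrable_of_hasCompactSupport
      (HasCompactSupport.intro hχc fun r hr => by simp [hχ0 r hr, hχ0' r hr])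
  -- The radial integrals over the whole line are really over `(0, ∞)`, since `χ` and its derivative
  -- vanish elsewhere.
  rw [← integral_mul_const, ← integral_mul_const, ← integral_sub (hi1.mul_const _)
    (hi2.mul_const _), ← setIntegral_eq_integral_of_forall_compl_eq_zero (s := Ioi (0 : ℝ))
    (fun r hr => by
      have hr' : r ∉ tsupport χ := fun h => hr (hχs h)
      simp [hχ0 r hr', hχ0' r hr'])]
  refine setIntegral_congr_fun measurableSet_Ioi fun r hr => ?_
  have hr0 : (0 : ℝ) < r := hr
  have hGr : ∀ θ : Metric.sphere (0 : RN N) 1, G (r • (θ : RN N), t)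
      = e t (r • (θ : RN N)) * (χ r * deriv ψ t)
        - inner ℝ (f t (r • (θ : RN N))) (θ : RN N) * (deriv χ r * ψ t)
        - d t (r • (θ : RN N)) * (χ r * ψ t) := by
    intro θ
    have hθ : ‖r • (θ : RN N)‖ = r := by
      rw [norm_smul, norm_eq_of_mem_sphere, mul_one, Real.norm_of_nonneg hr0.le]
    simp only [hG, hφdef, fderiv_comp_norm_mul_apply hχd hχs hψd, hθ, smul_smul,
      inv_mul_cancel₀ hr0.ne', one_smul, inner_zero_left]
    ring
  simp only [hGr]
  have hi3 : Integrable (fun θ : Metric.sphere (0 : RN N) 1 =>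
      e t (r • (θ : RN N)) * (χ r * deriv ψ t)
        - inner ℝ (f t (r • (θ : RN N))) (θ : RN N) * (deriv χ r * ψ t)) σ :=
    ((hsph het r).mul_const _).sub ((hfs r).mul_const _)
  rw [integral_sub hi3 ((hsph hdt r).mul_const _),
    integral_sub ((hsph het r).mul_const _) ((hfs r).mul_const _),
    integral_mul_const, integral_mul_const, integral_mul_const]
  ring

/-- Energy balance over spheres: the flux through the sphere of radius `r`, integrated over
`[0, T]`, is differentiable in `r`. -/
theorem EnergyBalance.hasDerivAt_flux {N : ℕ} (hN : N ≠ 0) {e : ℝ → RN N → ℝ}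
    {f : ℝ → RN N → RN N} {d : ℝ → RN N → ℝ} (he : Continuous (Function.uncurry e))
    (hf : Continuous (Function.uncurry f)) (hd : Continuous (Function.uncurry d))
    (h : EnergyBalance e f d) {T : ℝ} (hT : 0 < T) {r : ℝ} (hr : 0 < r) :
    HasDerivAt (fun r => r ^ (N - 1) * ∫ t in (0 : ℝ)..T, ∫ θ : Metric.sphere (0 : RN N) 1,
        inner ℝ (f t (r • (θ : RN N))) (θ : RN N) ∂(volume : Measure (RN N)).toSphere)
      (r ^ (N - 1) *
        ((∫ θ : Metric.sphere (0 : RN N) 1, e T (r • (θ : RN N))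
            ∂(volume : Measure (RN N)).toSphere)
          - (∫ θ : Metric.sphere (0 : RN N) 1, e 0 (r • (θ : RN N))
            ∂(volume : Measure (RN N)).toSphere)
          + ∫ t in (0 : ℝ)..T, ∫ θ : Metric.sphere (0 : RN N) 1, d t (r • (θ : RN N))
            ∂(volume : Measure (RN N)).toSphere)) r := by
  have hrad := fun {χ ψ : ℝ → ℝ} => h.integral_radial_eq_zero (χ := χ) (ψ := ψ) hN he hf hd
  set σ := (volume : Measure (RN N)).toSphere
  have hcE : Continuous fun p : ℝ × ℝ =>
      ∫ θ : Metric.sphere (0 : RN N) 1, e p.1 (p.2 • (θ : RN N)) ∂σ :=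
    continuous_integral_of_compactSpace σ (he.comp
      (by fun_prop : Continuous fun q : (ℝ × ℝ) × Metric.sphere (0 : RN N) 1 =>
        (q.1.1, q.1.2 • (q.2 : RN N))))
  have hcD : Continuous fun p : ℝ × ℝ =>
      ∫ θ : Metric.sphere (0 : RN N) 1, d p.1 (p.2 • (θ : RN N)) ∂σ :=
    continuous_integral_of_compactSpace σ (hd.comp
      (by fun_prop : Continuous fun q : (ℝ × ℝ) × Metric.sphere (0 : RN N) 1 =>
        (q.1.1, q.1.2 • (q.2 : RN N))))
  have hcF : Continuous fun p : ℝ × ℝ =>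
      ∫ θ : Metric.sphere (0 : RN N) 1, inner ℝ (f p.1 (p.2 • (θ : RN N))) (θ : RN N) ∂σ :=
    continuous_integral_of_compactSpace σ ((hf.comp
      (by fun_prop : Continuous fun q : (ℝ × ℝ) × Metric.sphere (0 : RN N) 1 =>
        (q.1.1, q.1.2 • (q.2 : RN N)))).inner (by fun_prop))
  set E : ℝ → ℝ → ℝ := fun t r => ∫ θ : Metric.sphere (0 : RN N) 1, e t (r • (θ : RN N)) ∂σ
  set D : ℝ → ℝ → ℝ := fun t r => ∫ θ : Metric.sphere (0 : RN N) 1, d t (r • (θ : RN N)) ∂σ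
  set F : ℝ → ℝ → ℝ := fun t r => ∫ θ : Metric.sphere (0 : RN N) 1,
    inner ℝ (f t (r • (θ : RN N))) (θ : RN N) ∂σ
  change Continuous (Function.uncurry E) at hcE
  change Continuous (Function.uncurry D) at hcD
  change Continuous (Function.uncurry F) at hcF
  have hcE' : Continuous fun p : ℝ × ℝ => E p.1 p.2 := hcE
  have hcD' : Continuous fun p : ℝ × ℝ => D p.1 p.2 := hcD
  have hcF' : Continuous fun p : ℝ × ℝ => F p.1 p.2 := hcF
  have hEt : ∀ t, Continuous (E t) := fun t =>
    hcE.comp (by fun_prop : Continuous fun r : ℝ => (t, r))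
  have hZ : Continuous fun r => ∫ t in (0 : ℝ)..T, F t r :=
    intervalIntegral.continuous_parametric_intervalIntegral_of_continuous'
      (f := fun r t => F t r) (hcF.comp continuous_swap) 0 T
  have hM : Continuous fun r => ∫ t in (0 : ℝ)..T, D t r :=
    intervalIntegral.continuous_parametric_intervalIntegral_of_continuous'
      (f := fun r t => D t r) (hcD.comp continuous_swap) 0 T
  refine hasDerivAt_of_integral_mul_deriv_add_eq_zero
    (A := fun r => r ^ (N - 1) * ∫ t in (0 : ℝ)..T, F t r)
    (B := fun r => r ^ (N - 1) * (E T r - E 0 r + ∫ t in (0 : ℝ)..T, D t r))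
    ((continuous_pow _).mul hZ)
    ((continuous_pow _).mul (((hEt T).sub (hEt 0)).add hM)) (fun χ hχ hχc hχs => ?_) hr
  have hχ' : Continuous (deriv χ) := hχ.continuous_deriv (by simp)
  have hχ0 : ∀ r, r ∉ tsupport χ → χ r = 0 := fun r hr => image_eq_zero_of_notMem_tsupport hr
  have hχ0' : ∀ r, r ∉ tsupport χ → deriv χ r = 0 := fun r hr => by
    by_contra h2
    exact hr (support_deriv_subset h2)
  have hgA : Continuous (Function.uncurry fun t r => r ^ (N - 1) * E t r * χ r) :=
    ((continuous_snd.pow _).mul hcE').mul (hχ.continuous.comp continuous_snd)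
  have hgB : Continuous (Function.uncurry fun t r =>
      r ^ (N - 1) * (F t r * deriv χ r + D t r * χ r)) :=
    (continuous_snd.pow _).mul ((hcF'.mul (hχ'.comp continuous_snd)).add
      (hcD'.mul (hχ.continuous.comp continuous_snd)))
  have hB0 : ∀ t r, r ∉ tsupport χ →
      r ^ (N - 1) * (F t r * deriv χ r + D t r * χ r) = 0 := fun t r hr => by
    simp [hχ0 r hr, hχ0' r hr]
  have hAc : Continuous fun t => ∫ r, r ^ (N - 1) * E t r * χ r :=
    continuous_integral_of_forall_notMem_eq_zero hgA hχc.isCompact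
      fun t r hr => by simp [hχ0 r hr]
  have hBc : Continuous fun t => ∫ r, r ^ (N - 1) * (F t r * deriv χ r + D t r * χ r) :=
    continuous_integral_of_forall_notMem_eq_zero hgB hχc.isCompact hB0
  -- With `χ` fixed and `ψ` arbitrary, the radial identity is a weak derivative in `t`, hence a
  -- classical one.
  have hder : ∀ t, 0 < t → HasDerivAt (fun t => ∫ r, r ^ (N - 1) * E t r * χ r)
      (-∫ r, r ^ (N - 1) * (F t r * deriv χ r + D t r * χ r)) t := by
    intro t ht
    refine hasDerivAt_of_integral_mul_deriv_add_eq_zero hAc hBc.neg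
      (fun ψ hψ hψc hψs => ?_) ht
    refine Eq.trans (integral_congr_ae (Filter.Eventually.of_forall fun s => ?_))
      (hrad hχ hχc hχs hψ hψc hψs)
    change _ + -_ * _ = _
    rw [neg_mul, ← sub_eq_add_neg]
  -- The balance is known only for `t > 0`; continuity at `0` lets the integration start there.
  have hftc := intervalIntegral.integral_eq_sub_of_hasDerivAt_of_le hT.le hAc.continuousOn
    (fun t ht => hder t ht.1) (hBc.neg.intervalIntegrable 0 T)
  rw [intervalIntegral.integral_neg,
    intervalIntegral_integral_comm_of_forall_notMem_eq_zero hgB hχc.isCompact hB0 hT.le,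
    ← integral_sub] at hftc
  rotate_left
  · exact ((((continuous_pow _).mul (hEt T)).mul hχ.continuous)).integrable_of_hasCompactSupport
      hχc.mul_left
  · exact ((((continuous_pow _).mul (hEt 0)).mul hχ.continuous)).integrable_of_hasCompactSupport
      hχc.mul_left
  have hFi : ∀ r, IntervalIntegrable (fun t => F t r) volume 0 T := fun r =>
    (hcF.comp (by fun_prop : Continuous fun t : ℝ => (t, r))).intervalIntegrable _ _
  have hDi : ∀ r, IntervalIntegrable (fun t => D t r) volume 0 T := fun r =>
    (hcD.comp (by fun_prop : Continuous fun t : ℝ => (t, r))).intervalIntegrable _ _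
  have hin : ∀ r, ∫ t in (0 : ℝ)..T, r ^ (N - 1) * (F t r * deriv χ r + D t r * χ r)
      = r ^ (N - 1) * ((∫ t in (0 : ℝ)..T, F t r) * deriv χ r
        + (∫ t in (0 : ℝ)..T, D t r) * χ r) := by
    intro r
    rw [intervalIntegral.integral_const_mul, intervalIntegral.integral_add
      ((hFi r).mul_const _) ((hDi r).mul_const _), intervalIntegral.integral_mul_const,
      intervalIntegral.integral_mul_const]
  simp only [hin] at hftc
  rw [neg_eq_iff_add_eq_zero, ← integral_add] at hftc
  rotate_left
  · exact ((continuous_pow _).mul ((hZ.mul hχ').add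
      (hM.mul hχ.continuous))).integrable_of_hasCompactSupport
      (HasCompactSupport.intro hχc fun r hr => by simp [hχ0 r hr, hχ0' r hr])
  · exact (((((continuous_pow _).mul (hEt T)).mul hχ.continuous)).sub
      (((continuous_pow _).mul (hEt 0)).mul hχ.continuous)).integrable_of_hasCompactSupport
      (HasCompactSupport.intro hχc fun r hr => by simp [hχ0 r hr])
  refine Eq.trans ?_ hftc
  refine integral_congr_ae (Filter.Eventually.of_forall fun r => ?_)
  simp only
  ring

/-- Cauchy-Schwarz bound of the integrated flux by the integrated dissipation. -/
theorem sq_integral_flux_le {N : ℕ} {f : ℝ → RN N → RN N} {d : ℝ → RN N → ℝ}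
    (hf : Continuous (Function.uncurry f)) (hd : Continuous (Function.uncurry d)) {β T : ℝ}
    (hT : 0 < T) (hω : 0 < (volume : Measure (RN N)).toSphere.real univ)
    (hfd : ∀ t, 0 ≤ t → ∀ x, ‖f t x‖ ^ 2 ≤ β * d t x) (r : ℝ) :
    (∫ t in (0 : ℝ)..T, ∫ θ : Metric.sphere (0 : RN N) 1,
        inner ℝ (f t (r • (θ : RN N))) (θ : RN N) ∂(volume : Measure (RN N)).toSphere) ^ 2
      ≤ T * (volume : Measure (RN N)).toSphere.real univ *
        (β * ∫ t in (0 : ℝ)..T, ∫ θ : Metric.sphere (0 : RN N) 1, d t (r • (θ : RN N))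
          ∂(volume : Measure (RN N)).toSphere) := by
  set σ := (volume : Measure (RN N)).toSphere
  have hgD : Continuous fun q : ℝ × Metric.sphere (0 : RN N) 1 => d q.1 (r • (q.2 : RN N)) :=
    hd.comp (by fun_prop : Continuous fun q : ℝ × Metric.sphere (0 : RN N) 1 =>
        (q.1, r • (q.2 : RN N)))
  have hgF : Continuous fun q : ℝ × Metric.sphere (0 : RN N) 1 =>
      inner ℝ (f q.1 (r • (q.2 : RN N))) (q.2 : RN N) :=
    (hf.comp (by fun_prop : Continuous fun q : ℝ × Metric.sphere (0 : RN N) 1 =>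
        (q.1, r • (q.2 : RN N)))).inner (by fun_prop)
  have hcD : Continuous fun t => ∫ θ : Metric.sphere (0 : RN N) 1, d t (r • (θ : RN N)) ∂σ :=
    continuous_integral_of_compactSpace σ hgD
  have hcF : Continuous fun t => ∫ θ : Metric.sphere (0 : RN N) 1,
      inner ℝ (f t (r • (θ : RN N))) (θ : RN N) ∂σ :=
    continuous_integral_of_compactSpace σ hgF
  -- Linearized Cauchy-Schwarz: integrate `2c(f·θ) - c² ≤ (f·θ)² ≤ β d`, then take for `c` the mean
  -- of `f·θ`, which is optimal.
  have hlin : ∀ c : ℝ, 2 * c * (∫ t in (0 : ℝ)..T, ∫ θ : Metric.sphere (0 : RN N) 1,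
        inner ℝ (f t (r • (θ : RN N))) (θ : RN N) ∂σ) - c ^ 2 * (T * σ.real univ)
      ≤ β * ∫ t in (0 : ℝ)..T, ∫ θ : Metric.sphere (0 : RN N) 1, d t (r • (θ : RN N)) ∂σ := by
    intro c
    have hpt : ∀ t ∈ Icc (0 : ℝ) T, 2 * c * (∫ θ : Metric.sphere (0 : RN N) 1,
          inner ℝ (f t (r • (θ : RN N))) (θ : RN N) ∂σ) - c ^ 2 * σ.real univ
        ≤ β * ∫ θ : Metric.sphere (0 : RN N) 1, d t (r • (θ : RN N)) ∂σ := by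
      intro t ht
      have hiF : Integrable (fun θ : Metric.sphere (0 : RN N) 1 =>
          inner ℝ (f t (r • (θ : RN N))) (θ : RN N)) σ :=
        (hgF.comp (by fun_prop : Continuous fun θ : Metric.sphere (0 : RN N) 1 =>
          (t, θ))).integrable_of_hasCompactSupport (HasCompactSupport.of_compactSpace _)
      have hiD : Integrable (fun θ : Metric.sphere (0 : RN N) 1 => d t (r • (θ : RN N))) σ :=
        (hgD.comp (by fun_prop : Continuous fun θ : Metric.sphere (0 : RN N) 1 =>
          (t, θ))).integrable_of_hasCompactSupport (HasCompactSupport.of_compactSpace _)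
      have hmono := integral_mono ((hiF.const_mul (2 * c)).sub (integrable_const (c ^ 2)))
        (hiD.const_mul β) fun θ => by
          have h1 := hfd t ht.1 (r • (θ : RN N))
          have h2 := abs_real_inner_le_norm (f t (r • (θ : RN N))) (θ : RN N)
          rw [norm_eq_of_mem_sphere, mul_one] at h2
          have h3 := sq_le_sq' (neg_le_of_abs_le h2) (le_of_abs_le h2)
          simp only [Pi.sub_apply]
          nlinarith [sq_nonneg (inner ℝ (f t (r • (θ : RN N))) (θ : RN N) - c)]
      simp only [Pi.sub_apply] at hmono
      rw [integral_sub (hiF.const_mul _) (integrable_const _), integral_const_mul,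
        integral_const_mul, integral_const, smul_eq_mul] at hmono
      linarith
    have hmono := intervalIntegral.integral_mono_on hT.le
      (((continuous_const.mul hcF).sub continuous_const).intervalIntegrable (μ := volume) 0 T)
      ((continuous_const.mul hcD).intervalIntegrable 0 T) hpt
    simp only [Pi.sub_apply, Pi.mul_apply] at hmono
    rw [intervalIntegral.integral_sub ((hcF.intervalIntegrable 0 T).const_mul _)
      (continuous_const.intervalIntegrable 0 T), intervalIntegral.integral_const_mul,
      intervalIntegral.integral_const_mul, intervalIntegral.integral_const_mul,
      intervalIntegral.integral_const, smul_eq_mul] at hmono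
    linarith
  generalize (∫ t in (0 : ℝ)..T, ∫ θ : Metric.sphere (0 : RN N) 1,
    inner ℝ (f t (r • (θ : RN N))) (θ : RN N) ∂σ) = Z at hlin ⊢
  have hTω : 0 < T * σ.real univ := by positivity
  have h1 := mul_le_mul_of_nonneg_left (hlin (Z / (T * σ.real univ))) hTω.le
  refine le_trans (le_of_eq ?_) h1
  field_simp
  ring

/-! ### The Riccati inequality for the flux density -/

namespace ExtendedDissipativeSystem

variable {N : ℕ} {X : Type*} [TopologicalSpace X] [TopologicalSpace.MetrizableSpace X]
  {Φ : Flow ℝ≥0 X} (S : ExtendedDissipativeSystem N X Φ) (u₀ : X)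

theorem integratedFlux_eq {R : ℝ} (hR : 0 < R) (T : ℝ) :
    S.integratedFlux u₀ R T = R ^ (N - 1) * ∫ t in (0 : ℝ)..T,
      ∫ θ : Metric.sphere (0 : RN N) 1, inner ℝ (S.f (Φ t.toNNReal u₀) (R • (θ : RN N)))
        (θ : RN N) ∂(volume : Measure (RN N)).toSphere := by
  rw [integratedFlux, ← intervalIntegral.integral_const_mul]
  congr 1
  ext t
  rw [sphereMeasure, integral_smul_measure, ENNReal.toReal_ofReal (by positivity), smul_eq_mul,
    integral_map (Continuous.aemeasurable (by fun_prop))]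
  · congr 1
    refine integral_congr_ae (Filter.Eventually.of_forall fun θ => ?_)
    simp only [norm_smul, norm_eq_of_mem_sphere, mul_one, Real.norm_of_nonneg hR.le, smul_smul,
      inv_mul_cancel₀ hR.ne', one_smul]
  · refine Measurable.aestronglyMeasurable ?_
    exact (S.f (Φ t.toNNReal u₀)).continuous.measurable.inner
      (measurable_norm.inv.smul measurable_id)

/-- The flux density `y(r) = F(r,T) / (ω_N r^{N-1})` is a supersolution of a Riccati equation. -/
theorem exists_hasDerivAt_flux (hN : N ≠ 0) {e₀ β : ℝ} (hβ : 0 < β)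
    (h_init : ∀ x : RN N, S.e u₀ x ≤ e₀)
    (h_flux : ∀ (t : ℝ≥0) (x : RN N), ‖S.f (Φ t u₀) x‖ ^ 2 ≤ β * S.d (Φ t u₀) x)
    {T : ℝ} (hT : 0 < T) :
    ∃ y' : ℝ → ℝ, ∀ r, 0 < r →
      HasDerivAt (fun r => S.integratedFlux u₀ r T / (omegaN N * r ^ (N - 1))) (y' r) r ∧
      -e₀ + (S.integratedFlux u₀ r T / (omegaN N * r ^ (N - 1))) ^ 2 / (β * T)
        ≤ y' r + ((N : ℝ) - 1) / r * (S.integratedFlux u₀ r T / (omegaN N * r ^ (N - 1))) := by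
  -- `Real.toNNReal` freezes the trajectory at `u₀` for `t ≤ 0`, so it is continuous on the whole
  -- line.
  have htraj : Continuous fun t : ℝ => Φ t.toNNReal u₀ :=
    Φ.continuous continuous_real_toNNReal continuous_const
  have he : Continuous (Function.uncurry fun (t : ℝ) x => S.e (Φ t.toNNReal u₀) x) :=
    ((S.continuous_e.comp htraj).comp continuous_fst).eval continuous_snd
  have hf : Continuous (Function.uncurry fun (t : ℝ) x => S.f (Φ t.toNNReal u₀) x) :=
    ((S.continuous_f.comp htraj).comp continuous_fst).eval continuous_snd
  have hd : Continuous (Function.uncurry fun (t : ℝ) x => S.d (Φ t.toNNReal u₀) x) :=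
    ((S.continuous_d.comp htraj).comp continuous_fst).eval continuous_snd
  have hω := toSphere_real_univ_eq_omegaN hN
  have hω0 : 0 < omegaN N := by
    have := Real.Gamma_pos_of_pos (s := (N : ℝ) / 2) (by positivity)
    unfold omegaN
    positivity
  have hder := fun {r : ℝ} (hr : 0 < r) =>
    (S.energy_balance u₀).hasDerivAt_flux hN he hf hd hT hr
  have hCS := sq_integral_flux_le hf hd hT (hω.symm ▸ hω0)
    (fun t _ x => h_flux t.toNNReal x)
  rw [hω] at hCS
  set σ := (volume : Measure (RN N)).toSphere
  have hE0 : ∀ r : ℝ, ∫ θ : Metric.sphere (0 : RN N) 1,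
      S.e (Φ (0 : ℝ).toNNReal u₀) (r • (θ : RN N)) ∂σ ≤ e₀ * omegaN N := by
    intro r
    rw [Real.toNNReal_zero, Φ.map_zero_apply]
    have hi : Integrable (fun θ : Metric.sphere (0 : RN N) 1 => S.e u₀ (r • (θ : RN N))) σ :=
      ((S.e u₀).continuous.comp (by fun_prop)).integrable_of_hasCompactSupport
        (HasCompactSupport.of_compactSpace _)
    refine (integral_mono hi (integrable_const e₀) fun θ => h_init _).trans (le_of_eq ?_)
    rw [integral_const, hω, smul_eq_mul, mul_comm]
  have hET : ∀ r : ℝ, 0 ≤ ∫ θ : Metric.sphere (0 : RN N) 1,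
      S.e (Φ T.toNNReal u₀) (r • (θ : RN N)) ∂σ :=
    fun r => integral_nonneg fun θ => S.e_nonneg _ _
  set Z : ℝ → ℝ := fun r => ∫ t in (0 : ℝ)..T, ∫ θ : Metric.sphere (0 : RN N) 1,
    inner ℝ (S.f (Φ t.toNNReal u₀) (r • (θ : RN N))) (θ : RN N) ∂σ with hZ
  have hy : ∀ r, 0 < r → S.integratedFlux u₀ r T / (omegaN N * r ^ (N - 1))
      = Z r / omegaN N := by
    intro r hr
    rw [S.integratedFlux_eq u₀ hr, mul_comm (omegaN N), mul_div_mul_left _ _ (by positivity)]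
  set M : ℝ → ℝ := fun r =>
    (∫ θ : Metric.sphere (0 : RN N) 1, S.e (Φ T.toNNReal u₀) (r • (θ : RN N)) ∂σ)
    - (∫ θ : Metric.sphere (0 : RN N) 1, S.e (Φ (0 : ℝ).toNNReal u₀) (r • (θ : RN N)) ∂σ)
    + ∫ t in (0 : ℝ)..T, ∫ θ : Metric.sphere (0 : RN N) 1,
      S.d (Φ t.toNNReal u₀) (r • (θ : RN N)) ∂σ with hM
  -- By the quotient rule for `r^{N-1} Z / (ω_N r^{N-1})`, with `r^{N-1} M` as derivative of the
  -- numerator; thus `y' + (N-1)/r · y = M/ω_N`.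
  refine ⟨fun r => M r / omegaN N - ((N : ℝ) - 1) / r * (Z r / omegaN N), fun r hr => ⟨?_, ?_⟩⟩
  · have hN1 : ((N - 1 : ℕ) : ℝ) = (N : ℝ) - 1 := by
      rw [Nat.cast_sub (Nat.one_le_iff_ne_zero.2 hN), Nat.cast_one]
    have hpow : HasDerivAt (fun r : ℝ => omegaN N * r ^ (N - 1))
        (omegaN N * (((N : ℝ) - 1) / r * r ^ (N - 1))) r := by
      refine ((hasDerivAt_pow (N - 1) r).const_mul (omegaN N)).congr_deriv ?_
      -- The power rule contains the truncated exponent `N - 1 - 1`, so exponent zero is treated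
      -- apart.
      rcases Nat.eq_zero_or_pos (N - 1) with h0 | h0
      · rw [← hN1, h0]
        simp
      · rw [← hN1, ← Nat.succ_pred_eq_of_pos h0]
        simp only [Nat.succ_eq_add_one, Nat.add_sub_cancel, pow_succ]
        field_simp
    have hq := (hder hr).div hpow (by positivity)
    refine (hq.congr_of_eventuallyEq ?_).congr_deriv ?_
    · filter_upwards [Ioi_mem_nhds hr] with x hx
      rw [S.integratedFlux_eq u₀ hx]
      rfl
    · change (r ^ (N - 1) * M r * _ - r ^ (N - 1) * Z r * _) / _ = _
      field_simp
  · rw [hy r hr, sub_add_cancel]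
    have h1 := hCS r
    change Z r ^ 2 ≤ _ at h1
    have h2 : Z r ^ 2 / (T * omegaN N * β) ≤ ∫ t in (0 : ℝ)..T,
        ∫ θ : Metric.sphere (0 : RN N) 1, S.d (Φ t.toNNReal u₀) (r • (θ : RN N)) ∂σ := by
      rw [div_le_iff₀ (by positivity)]
      linarith
    rw [le_div_iff₀ hω0]
    have h3 : (-e₀ + (Z r / omegaN N) ^ 2 / (β * T)) * omegaN N
        = -(e₀ * omegaN N) + Z r ^ 2 / (T * omegaN N * β) := by
      field_simp
    rw [h3, hM]
    linarith [hE0 r, hET r]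

end ExtendedDissipativeSystem

theorem proposition3p3 (N : ℕ) (hN2 : 2 ≤ N) (X : Type*) [TopologicalSpace X]
    [TopologicalSpace.MetrizableSpace X] (Φ : Flow ℝ≥0 X)
    (S : ExtendedDissipativeSystem N X Φ) (u₀ : X) (e₀ β : ℝ) (he₀ : 0 < e₀) (hβ : 0 < β)
    (h_init : ∀ x : RN N, S.e u₀ x ≤ e₀)
    (h_flux : ∀ (t : ℝ≥0) (x : RN N), ‖S.f (Φ t u₀) x‖ ^ 2 ≤ β * S.d (Φ t u₀) x) :
    IsPositiveRiccatiSolution N (hN N) ∧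
    (∀ H : ℝ → ℝ, IsPositiveRiccatiSolution N H → ∀ r : ℝ, 0 < r → H r = hN N r) ∧
    ∀ R T : ℝ, 0 < R → 0 < T →
      S.integratedFlux u₀ R T / (omegaN N * R ^ (N - 1)) ≤
        √(β * T * e₀) * hN N (R * √(e₀ / (β * T))) := by
  refine ⟨isPositiveRiccatiSolution_hN hN2, fun H hH r hr => hH.eq_hN hN2 hr,
    fun R T hR hT => ?_⟩
  have h2 : (2 : ℝ) ≤ N := by exact_mod_cast hN2
  obtain ⟨y', hy'⟩ := S.exists_hasDerivAt_flux u₀ (by omega) hβ h_init h_flux hT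
  set y : ℝ → ℝ := fun r => S.integratedFlux u₀ r T / (omegaN N * r ^ (N - 1))
  change y R ≤ _
  -- Scaling `y(r) = a H(kr)`: the relations `ak = e₀` and `a² = βT e₀` are those that turn both
  -- constants of the inequality into `1`.
  set a := √(β * T * e₀) with ha
  set k := √(e₀ / (β * T)) with hk
  have ha0 : 0 < a := Real.sqrt_pos.2 (by positivity)
  have hk0 : 0 < k := Real.sqrt_pos.2 (by positivity)
  have ha2 : a ^ 2 = β * T * e₀ := Real.sq_sqrt (by positivity)
  have hak : a * k = e₀ := by
    rw [ha, hk, ← Real.sqrt_mul (by positivity)]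
    rw [show β * T * e₀ * (e₀ / (β * T)) = e₀ ^ 2 by field_simp]
    exact Real.sqrt_sq he₀.le
  have key := riccati_supersolution_le (c := (N : ℝ) - 1) (by linarith)
    (H := fun s => y (s / k) / a) (H' := fun s => y' (s / k) * (1 / k) / a) (h := hN N)
    (fun s hs => by
      have h3 : HasDerivAt (fun s : ℝ => s / k) (1 / k) s := (hasDerivAt_id s).div_const k
      exact ((hy' (s / k) (by positivity)).1.comp s h3).div_const a)
    (fun s hs => by
      have h3 := (hy' (s / k) (by positivity)).2
      change -e₀ + y (s / k) ^ 2 / (β * T) ≤ y' (s / k) + ((N : ℝ) - 1) / (s / k) * y (s / k) at h3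
      have h4 : y' (s / k) * (1 / k) / a + ((N : ℝ) - 1) / s * (y (s / k) / a)
          = (y' (s / k) + ((N : ℝ) - 1) / (s / k) * y (s / k)) / e₀ := by
        rw [← hak]
        field_simp
      have h5 : -1 + (y (s / k) / a) ^ 2 = (-e₀ + y (s / k) ^ 2 / (β * T)) / e₀ := by
        rw [div_pow, ha2]
        field_simp
      rw [h4, h5]
      gcongr)
    (fun s hs => hasDerivAt_hN N hs) (fun s _ => by ring) (fun s hs => one_le_hN hN2 hs)
    (r := R * k) (by positivity)
  simp only [mul_div_cancel_right₀ R hk0.ne'] at key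
  rw [div_le_iff₀ ha0] at key
  linarith
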